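/- Let $M$ be a smooth connected manifold, possibly with boundary (finite-dimensional, Hausdorff, second countable), and let $(\Omega,\mathcal F,P)$ be a probability space. Let $\xi : M\times[0,\infty)\times\Omega\to M$ be a stochastic flow with continuous sample paths, that is, a map for which there is a set $N\subset\Omega$ of measure $0$ such that, writing $\xi_{t,\omega}(x)=\xi(x,t,\omega)$, for all $x\in M$, $s,t\ge 0$ and $\omega\in\Omega\setminus N$: (a) $\xi_{t,\omega}: M\to M$ is a homeomorphism; (b) $\xi_{0,\omega}(x)=x$; (c) $\xi_{t,\omega}(\xi_{s,\omega}(x))=\xi_{s+t,\omega}(x)$; (d) the orbit map $[0,\infty)\to M$, $r\mapsto \xi_{r,\omega}(x)$, is continuous. Let $K\subset M$ be compact and let $W$ be a neighbourhood of $K$. For $x\in K$ let $\tau_{x,W}(\omega)=\inf\{t\ge 0 : \xi_{t,\omega}(x)\notin W\}\in[0,\infty]$ (with $\inf\varnothing=\infty$) be the first exit time from $W$ of the trajectory started at $x$. Suppose that for every $\varepsilon>0$ there exists $\delta>0$ such that $$P\bigl(\{\omega\in\Omega : \exists\, x\in K,\ \tau_{x,W}(\omega)\le\delta\}\bigr)\le\varepsilon$$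 (where $P$ denotes the outer measure if this set is not measurable). Then for almost all $\omega\in\Omega$ and all $t\ge 0$, the restriction $\xi_{t,\omega}|_K : K\to M$ is homotopic to the inclusion $K\subset M$, i.e. there is a continuous map $F:K\times[0,1]\to M$ with $F(x,0)=\xi_{t,\omega}(x)$ and $F(x,1)=x$ for all $x\in K$. -/

import Mathlib

open MeasureTheory Topology
open scoped NNReal ENNReal

/-- A complete, homogeneous in time stochastic flow of homeomorphisms of `M` over the
probability space `(Ω, P)`: for all `ω` outside one null set, each `ξ_{t,ω}` is a homeomorphism
of `M`, `ξ_{0,ω}` is the identity, and `ξ_{t,ω} ∘ ξ_{s,ω} = ξ_{s+t,ω}`. -/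
def IsStochasticFlow {Ω M : Type*} [MeasurableSpace Ω] [TopologicalSpace M]
    (P : Measure Ω) (ξ : M → ℝ≥0 → Ω → M) : Prop :=
  ∀ᵐ ω ∂P,
    (∀ t : ℝ≥0, IsHomeomorph (fun x : M => ξ x t ω)) ∧
    (∀ x : M, ξ x 0 ω = x) ∧
    (∀ (x : M) (s t : ℝ≥0), ξ (ξ x s ω) t ω = ξ x (s + t) ω)

/-- Sample path continuity: for all `ω` outside one null set, every orbit map
`t ↦ ξ_{t,ω}(x)` is continuous on `[0, ∞)`. -/
def HasContinuousSamplePaths {Ω M : Type*} [MeasurableSpace Ω] [TopologicalSpace M]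
    (P : Measure Ω) (ξ : M → ℝ≥0 → Ω → M) : Prop :=
  ∀ᵐ ω ∂P, ∀ x : M, Continuous (fun t : ℝ≥0 => ξ x t ω)

/-- The first exit time from `W` of the trajectory started at `x`, that is
`inf {t ≥ 0 | ξ_{t,ω}(x) ∉ W}`, equal to `⊤` (infinity) if the trajectory never leaves `W`. -/
noncomputable def exitTime {Ω M : Type*} (ξ : M → ℝ≥0 → Ω → M) (W : Set M) (x : M) :
    Ω → WithTop ℝ≥0 :=
  hittingAfter (fun (t : ℝ≥0) (ω : Ω) => ξ x t ω) Wᶜ 0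

/-- Two maps are homotopic: both are continuous, and there is a homotopy between them. -/
def AreHomotopic {A B : Type*} [TopologicalSpace A] [TopologicalSpace B] (f g : A → B) : Prop :=
  ∃ (hf : Continuous f) (hg : Continuous g),
    ContinuousMap.Homotopic (⟨f, hf⟩ : C(A, B)) (⟨g, hg⟩ : C(A, B))

/-!
For every `ω` outside a null set, `ξ_{t,ω}` is a one-parameter semigroup of homeomorphisms whose
orbits are continuous, so `(t, x) ↦ ξ_{t,ω}(x)` is separately continuous. The point is that it is
then jointly continuous, so that running the flow backwards along the orbits,
`(s, x) ↦ ξ_{(1-s)t,ω}(x)`, is a homotopy from `ξ_{t,ω}` to the identity.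

Joint continuity is a Baire category argument. For a separately continuous map `f : T × X → Y`
from a Baire space `T` and a first countable space `X` to a metric space, and for each fixed
`x₀`, the map `f` is jointly continuous at `(t, x₀)` for a dense set of `t`
(`dense_setOf_continuousAt_of_separately_continuous`). A manifold is metrizable, so this yields
some `r > 0` such that the flow is jointly continuous at `(r, x₀)`. The identity
`ξ_r ∘ ξ_s = ξ_{s₀} ∘ ξ_{s + r - s₀}`, valid for `s` near `s₀`, together with the fact that `ξ_r`
is an embedding, transports the continuity from time `r` to an arbitrary time `s₀`
(`continuous_uncurry_of_semigroup_isHomeomorph`).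
-/

open Filter Set

/-- For a separately continuous map `f` into a metric space, and for fixed `x₀`, joint continuity
at `(t, x₀)` holds for a dense (in fact residual) set of parameters `t`. -/
theorem dense_setOf_continuousAt_of_separately_continuous
    {T X Y : Type*} [TopologicalSpace T] [BaireSpace T] [TopologicalSpace X]
    [FirstCountableTopology X] [PseudoMetricSpace Y] {f : T → X → Y}
    (hT : ∀ x, Continuous fun t => f t x) (hX : ∀ t, Continuous (f t)) (x₀ : X) :
    Dense {t | ContinuousAt (Function.uncurry f) (t, x₀)} := by
  obtain ⟨V, hV⟩ := (𝓝 x₀).exists_antitone_basis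
  let ε : ℕ → ℝ := fun k => 1 / ((k : ℝ) + 1)
  -- The times at which `f` oscillates by at most `ε k` around its value at `x₀`, on all of `V n`.
  let C : ℕ → ℕ → Set T := fun k n => {t | ∀ x ∈ V n, dist (f t x) (f t x₀) ≤ ε k}
  have hC : ∀ k n, IsClosed (C k n) := fun k n => by
    simp only [C, ofPred_forall]
    exact isClosed_biInter fun x _ => isClosed_le ((hT x).dist (hT x₀)) continuous_const
  have hCover : ∀ k, ⋃ n, C k n = univ := fun k => by
    refine eq_univ_of_forall fun t => mem_iUnion.2 ?_
    have hball := (hX t).continuousAt (x := x₀) (Metric.closedBall_mem_nhds (f t x₀)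
      (Nat.one_div_pos_of_nat (n := k) : 0 < ε k))
    obtain ⟨n, -, hn⟩ := hV.1.mem_iff.1 hball
    exact ⟨n, fun x hx => hn hx⟩
  have hdense : Dense (⋂ k, ⋃ n, interior (C k n)) :=
    dense_iInter_of_isOpen_nat (fun k => isOpen_iUnion fun n => isOpen_interior)
      fun k => dense_iUnion_interior_of_closed (hC k) (hCover k)
  refine hdense.mono fun t ht => ?_
  rw [mem_ofPred_eq, Metric.continuousAt_iff']
  intro η hη
  obtain ⟨k, hk⟩ := exists_nat_one_div_lt (half_pos hη)
  obtain ⟨n, hn⟩ := mem_iUnion.1 (mem_iInter.1 ht k)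
  have h1 : ∀ᶠ s in 𝓝 t, s ∈ C k n := mem_interior_iff_mem_nhds.1 hn
  have h2 : ∀ᶠ s in 𝓝 t, dist (f s x₀) (f t x₀) < η / 2 :=
    Metric.continuousAt_iff'.1 (hT x₀).continuousAt _ (half_pos hη)
  have h3 : ∀ᶠ x in 𝓝 x₀, x ∈ V n := hV.1.mem_of_mem trivial
  rw [nhds_prod_eq]
  filter_upwards [(h1.and h2).prod_mk h3] with p ⟨⟨hp1, hp2⟩, hp3⟩
  calc dist (f p.1 p.2) (f t x₀)
      ≤ dist (f p.1 p.2) (f p.1 x₀) + dist (f p.1 x₀) (f t x₀) := dist_triangle _ _ _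
    _ < η / 2 + η / 2 := add_lt_add ((hp1 _ hp3).trans_lt hk) hp2
    _ = η := add_halves η

/-- A one-parameter semigroup of homeomorphisms of a metrizable space with continuous orbits is
jointly continuous in time and space. -/
theorem continuous_uncurry_of_semigroup_isHomeomorph
    {X : Type*} [TopologicalSpace X] [TopologicalSpace.PseudoMetrizableSpace X]
    {φ : ℝ≥0 → X → X} (hhomeo : ∀ t, IsHomeomorph (φ t))
    (hadd : ∀ x s t, φ t (φ s x) = φ (s + t) x) (horbit : ∀ x, Continuous fun t => φ t x) :
    Continuous (Function.uncurry φ) := by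
  let _ := TopologicalSpace.pseudoMetrizableSpacePseudoMetric X
  refine continuous_iff_continuousAt.2 fun ⟨s₀, x₀⟩ => ?_
  -- Positivity of `r` makes the truncated difference `s + r - s₀` a true one for `s` near `s₀`.
  obtain ⟨r, hr : ContinuousAt (Function.uncurry φ) (r, x₀), hr0 : 0 < r⟩ :=
    (dense_setOf_continuousAt_of_separately_continuous horbit
      (fun t => (hhomeo t).continuous) x₀).exists_mem_open (isOpen_Ioi (a := 0)) ⟨1, mem_Ioi.2 one_pos⟩
  rw [(hhomeo r).isInducing.continuousAt_iff]
  have hshift : ContinuousAt (fun p : ℝ≥0 × X => (p.1 + r - s₀, p.2)) (s₀, x₀) := by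
    fun_prop
  have hcomp : ContinuousAt (fun p : ℝ≥0 × X => φ s₀ (φ (p.1 + r - s₀) p.2)) (s₀, x₀) := by
    refine (hhomeo s₀).continuous.continuousAt.comp ?_
    refine ContinuousAt.comp (g := Function.uncurry φ) ?_ hshift
    simpa using hr
  refine hcomp.congr ?_
  have hnear : ∀ᶠ p : ℝ≥0 × X in 𝓝 (s₀, x₀), s₀ < p.1 + r :=
    (continuous_fst.add continuous_const).continuousAt.eventually
      (lt_mem_nhds (lt_add_of_pos_right s₀ hr0))
  filter_upwards [hnear] with p hp
  simp only [Function.comp_apply, Function.uncurry, hadd]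
  rw [tsub_add_cancel_of_le hp.le]

theorem mainTheorem2
    {E : Type*} [NormedAddCommGroup E] [NormedSpace ℝ E] [FiniteDimensional ℝ E]
    {H : Type*} [TopologicalSpace H] (I : ModelWithCorners ℝ E H)
    {M : Type*} [TopologicalSpace M] [ChartedSpace H M] [IsManifold I ((⊤ : ℕ∞) : WithTop ℕ∞) M]
    [T2Space M] [SecondCountableTopology M] [ConnectedSpace M]
    {Ω : Type*} [MeasurableSpace Ω] (P : Measure Ω) [IsProbabilityMeasure P]
    (ξ : M → ℝ≥0 → Ω → M)
    (hflow : IsStochasticFlow P ξ) (hpaths : HasContinuousSamplePaths P ξ)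
    (K W : Set M) (hK : IsCompact K) (hW : W ∈ 𝓝ˢ K)
    (hexit : ∀ ε : ℝ≥0, 0 < ε → ∃ δ : ℝ≥0, 0 < δ ∧
      P {ω | ∃ x ∈ K, exitTime ξ W x ω ≤ (δ : WithTop ℝ≥0)} ≤ (ε : ℝ≥0∞)) :
    ∀ᵐ ω ∂P, ∀ t : ℝ≥0,
      AreHomotopic (fun x : K => ξ (x : M) t ω) (fun x : K => (x : M)) := by

  have : LocallyCompactSpace M := Manifold.locallyCompact_of_finiteDimensional I
  filter_upwards [hflow, hpaths] with ω ⟨hhomeo, hzero, hadd⟩ horbit t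
  have hjoint : Continuous (Function.uncurry fun (s : ℝ≥0) (x : M) => ξ x s ω) :=
    continuous_uncurry_of_semigroup_isHomeomorph hhomeo hadd horbit
  refine ⟨(hhomeo t).continuous.comp continuous_subtype_val, continuous_subtype_val, ⟨?_⟩⟩
  refine
    { toFun := fun p => ξ (p.2 : M) (unitInterval.toNNReal (unitInterval.symm p.1) * t) ω
      continuous_toFun := ?_
      map_zero_left := fun x => ?_
      map_one_left := fun x => ?_ }
  · have hparam : Continuous fun p : unitInterval × K =>
        (unitInterval.toNNReal (unitInterval.symm p.1) * t, (p.2 : M)) := by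
      fun_prop
    exact hjoint.comp hparam
  · simp
  · simp [hzero]
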